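/- For a probability measure $\mu$ with compact support on $\mathbb{R}$ write $G_\mu(z)=\int_{\mathbb R}\frac{\mu(dt)}{z-t}$ for its Stieltjes transform, and let $R_\mu$ be its $R$-transform, i.e. the function analytic near $0$ such that $w\mapsto R_\mu(w)+\frac1w$ is the compositional inverse of $G_\mu$ near infinity: $R_\mu(G_\mu(z))+\frac1{G_\mu(z)}=z$ for $|z|$ large. The free convolution $\mu\boxplus\nu$ is the compactly supported probability measure with $R_{\mu\boxplus\nu}=R_\mu+R_\nu$ near $0$. For $q\in(-1,0)\cup(0,1)$ put \[ R^{\mathrm{quant}(q)}_\mu(z)=R_\mu(z)-\frac{(1-qz)^{-1/q}}{(1-qz)^{-1/q}-1}+\frac1z \] for small $z\ne 0$, and say that a compactly supported probability measure $\rho$ equals $\mu\otimes_q\nu$ if $R^{\mathrm{quant}(q)}_\rho=R^{\mathrm{quant}(q)}_\mu+R^{\mathrm{quant}(q)}_\nu$ near $0$. All powers are principal branches. \textbf{Theorem.} Let $q\in(-1,0)\cup(0,1)$. For every probability measure $\mu$ with compact support on $\mathbb{R}$ there exist a unique compactly supported probability measure $\nu$ on $\mathbb R$ with \[ 1-G_\mu(z)=(1-qG_\nu(z))^{1/q}\quad\text{for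 all } z\in\mathbb{C} \text{ with } |z|^{-1} \text{ small enough,} \] and a unique compactly supported probability measure $\lambda$ on $\mathbb R$ with \[ 1+G_\mu(z-1)=(1-qG_\lambda(z))^{-1/q}\quad\text{for all } z\in\mathbb{C} \text{ with } |z|^{-1} \text{ small enough.} \] The maps $\mathfrak P:\mu\mapsto\nu$ and $\mathfrak Q:\mu\mapsto\lambda$ are injective. Moreover, whenever $\nu_1,\nu_2$ are compactly supported probability measures on $\mathbb R$ with free convolution $\nu_1\boxplus\nu_2$, the measures $\mathfrak P(\nu_1)\otimes_q\mathfrak P(\nu_2)$ and $\mathfrak Q(\nu_1)\otimes_q\mathfrak Q(\nu_2)$ exist, are unique, and \[ \mathfrak P(\nu_1\boxplus\nu_2)=\mathfrak P(\nu_1)\otimes_q\mathfrak P(\nu_2),\qquad \mathfrak Q(\nu_1\boxplus\nu_2)=\mathfrak Q(\nu_1)\otimes_q\mathfrak Q(\nu_2). \] -/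

import Mathlib

open MeasureTheory Filter Topology Bornology

/-- Probability measures on `ℝ` with compact support. -/
abbrev CompactProb : Type :=
  {μ : ProbabilityMeasure ℝ // IsCompact (μ : Measure ℝ).support}

/-- The Stieltjes transform `G_μ(z) = ∫ 1 / (z - t) dμ(t)`. -/
noncomputable def stieltjes (μ : CompactProb) (z : ℂ) : ℂ :=
  ∫ t : ℝ, (z - (t : ℂ))⁻¹ ∂(μ.1 : Measure ℝ)

/-- `R` is (a representative near `0` of) the `R`-transform of `μ`: it is analytic at `0` and
`w ↦ R(w) + 1 / w` is the compositional inverse of `G_μ` at infinity. Since `G_μ` maps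
neighbourhoods of infinity bijectively onto punctured neighbourhoods of `0`, this determines the
germ of `R` at `0`. -/
def IsRTransform (μ : CompactProb) (R : ℂ → ℂ) : Prop :=
  AnalyticAt ℂ R 0 ∧ ∀ᶠ z in cobounded ℂ, R (stieltjes μ z) + (stieltjes μ z)⁻¹ = z

/-- `ρ = μ ⊞ ν`: the `R`-transform of `ρ` is the sum of those of `μ` and `ν`. -/
def IsFreeConvolution (μ ν ρ : CompactProb) : Prop :=
  ∃ Rμ Rν Rρ : ℂ → ℂ, IsRTransform μ Rμ ∧ IsRTransform ν Rν ∧ IsRTransform ρ Rρ ∧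
    ∀ᶠ z in 𝓝 (0 : ℂ), Rρ z = Rμ z + Rν z

/-- The `q`-exponential `e_q(z) = (1 - q z)^(-1/q)` (principal branch, `z` near `0`). -/
noncomputable def qExp (q : ℝ) (z : ℂ) : ℂ :=
  (1 - (q : ℂ) * z) ^ (-1 / (q : ℂ))

/-- `S` is, near `0`, the `q`-deformed quantized `R`-transform
`R_μ(z) - e_q(z) / (e_q(z) - 1) + 1 / z` of `μ`. The singularity at `z = 0` is removable, and the
value of `S` at `0` is left free. -/
def IsQuantizedRTransform (q : ℝ) (μ : CompactProb) (S : ℂ → ℂ) : Prop :=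
  ∃ R : ℂ → ℂ, IsRTransform μ R ∧
    ∀ᶠ z in 𝓝[≠] (0 : ℂ), S z = R z - qExp q z / (qExp q z - 1) + 1 / z

/-- `ρ = μ ⊗_q ν`: the `q`-deformed quantized `R`-transform of `ρ` is the sum of those of
`μ` and `ν`. -/
def IsQuantizedConvolution (q : ℝ) (μ ν ρ : CompactProb) : Prop :=
  ∃ Sμ Sν Sρ : ℂ → ℂ, IsQuantizedRTransform q μ Sμ ∧ IsQuantizedRTransform q ν Sν ∧
    IsQuantizedRTransform q ρ Sρ ∧ ∀ᶠ z in 𝓝[≠] (0 : ℂ), Sρ z = Sμ z + Sν z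

/-- `1 - G_μ(z) = (1 - q G_ν(z))^(1/q)` for all `z` with `|z|` large enough. -/
def PRelation (q : ℝ) (μ ν : CompactProb) : Prop :=
  ∀ᶠ z in cobounded ℂ,
    1 - stieltjes μ z = (1 - (q : ℂ) * stieltjes ν z) ^ (1 / (q : ℂ))

/-- `1 + G_μ(z - 1) = (1 - q G_lam(z))^(-1/q)` for all `z` with `|z|` large enough. -/
def QRelation (q : ℝ) (μ lam : CompactProb) : Prop :=
  ∀ᶠ z in cobounded ℂ,
    1 + stieltjes μ (z - 1) = (1 - (q : ℂ) * stieltjes lam z) ^ (-1 / (q : ℂ))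

/-! Both relations have the form `G_μ(z - s) = φ(G_ν(z))` with `φ` analytic at `0` and `φ'(0) = 1`:
for `𝔓`, `s = 0` and `φ = 1 - 1 / e_q`; for `𝔔`, `s = 1` and `φ = e_q - 1`.

Existence is the hard part. For `-1 < q < 1`, `q ≠ 0`, there is a probability measure `κ` with `(1 -
(1 - g)^q) / q = ∫ g / (1 - c g) dκ`, where `0 < c < 1` (`exists_probabilityMeasure_integral_eq`).
If `A` is multiplication by `t` on `L²(μ)` and `v = 1`, then `G_μ / (1 - c G_μ)` is the Stieltjes
transform of the spectral measure at `v` of the rank-one perturbation `A + c ⟨v, ·⟩ v`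
(`inner_cfc_inv_sub_rankOne`). Averaging these spectral measures over `κ` gives `ν`
(`exists_average`). For `𝔔`, the same is done with `-q`, `-c` and `μ` translated by `1`.

Uniqueness and injectivity hold since `φ` is locally invertible and the germ of `G_μ` at infinity
determines `μ`. For convolutions, inverting the relation gives `R_ν(w) + 1/w = R_μ(φ(w)) + 1/φ(w) +
s`. In both cases `1/φ + s = e_q / (e_q - 1)`, so the quantized transform of `ν` is `R_μ ∘ φ`, and
additivity is inherited from `R_μ`. -/

open scoped InnerProductSpace CompactlySupported

/-! ### Stieltjes transforms near infinity. -/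

namespace CompactProb

lemma exists_ae_abs_le (μ : CompactProb) :
    ∃ M : ℝ, 0 < M ∧ ∀ᵐ t ∂(μ.1 : Measure ℝ), |t| ≤ M := by
  obtain ⟨M, hM⟩ := μ.2.isBounded.exists_norm_le
  refine ⟨max M 1, by positivity, ?_⟩
  filter_upwards [Measure.support_mem_ae (μ := (μ.1 : Measure ℝ))] with t ht
  exact (hM t ht).trans (le_max_left _ _)

/-- The moment generating series `w ↦ ∫ 1 / (1 - w t) dμ(t)`. -/
noncomputable def momentSeries (μ : CompactProb) (w : ℂ) : ℂ :=
  ∫ t : ℝ, (1 - w * (t : ℂ))⁻¹ ∂(μ.1 : Measure ℝ)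

/-- If `|t| ≤ M` almost everywhere, the geometric series in `w t` is dominated by `(‖w‖ M)^n` for
`‖w‖ < 1/M` and may be integrated termwise. -/
lemma hasFPowerSeriesAt_momentSeries (μ : CompactProb) :
    HasFPowerSeriesAt μ.momentSeries
      (FormalMultilinearSeries.ofScalars ℂ
        (fun n ↦ ∫ t : ℝ, (t : ℂ) ^ n ∂(μ.1 : Measure ℝ))) 0 := by
  rw [hasFPowerSeriesAt_iff]
  obtain ⟨M, hM0, hM⟩ := μ.exists_ae_abs_le
  have hball : Metric.ball (0 : ℂ) M⁻¹ ∈ 𝓝 (0 : ℂ) := Metric.ball_mem_nhds _ (by positivity)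
  filter_upwards [hball] with w hw
  have hw' : ‖w‖ * M < 1 := by
    rw [mem_ball_zero_iff] at hw
    calc ‖w‖ * M < M⁻¹ * M := by gcongr
      _ = 1 := inv_mul_cancel₀ hM0.ne'
  have hgeo : Summable fun n : ℕ ↦ (‖w‖ * M) ^ n :=
    summable_geometric_of_lt_one (by positivity) hw'
  have key := hasSum_integral_of_dominated_convergence (μ := (μ.1 : Measure ℝ))
    (F := fun n t ↦ (w * (t : ℂ)) ^ n) (f := fun t ↦ (1 - w * (t : ℂ))⁻¹)
    (fun n _ ↦ (‖w‖ * M) ^ n) (fun n ↦ by fun_prop) ?_ ?_ ?_ ?_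
  · simpa [momentSeries, mul_pow, integral_const_mul] using key
  · intro n
    filter_upwards [hM] with t ht
    rw [norm_pow, norm_mul, Complex.norm_real, Real.norm_eq_abs]
    gcongr
  · exact ae_of_all _ fun _ ↦ hgeo
  · exact integrable_const _
  · filter_upwards [hM] with t ht
    apply hasSum_geometric_of_norm_lt_one
    rw [norm_mul, Complex.norm_real, Real.norm_eq_abs]
    exact lt_of_le_of_lt (by gcongr) hw'

/-- The Stieltjes transform in the coordinate `w = 1 / z` at infinity. -/
noncomputable def stieltjesAtInfty (μ : CompactProb) (w : ℂ) : ℂ := w * μ.momentSeries w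

lemma analyticAt_stieltjesAtInfty (μ : CompactProb) : AnalyticAt ℂ μ.stieltjesAtInfty 0 :=
  analyticAt_id.mul μ.hasFPowerSeriesAt_momentSeries.analyticAt

@[simp] lemma stieltjesAtInfty_zero (μ : CompactProb) : μ.stieltjesAtInfty 0 = 0 := by
  simp [stieltjesAtInfty]

lemma deriv_stieltjesAtInfty_zero (μ : CompactProb) : deriv μ.stieltjesAtInfty 0 = 1 := by
  have h := (hasDerivAt_id (0 : ℂ)).mul
    μ.hasFPowerSeriesAt_momentSeries.analyticAt.differentiableAt.hasDerivAt
  have h2 : HasDerivAt μ.stieltjesAtInfty 1 0 := by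
    convert! h using 1
    simp [momentSeries]
  exact h2.deriv

lemma stieltjes_eq (μ : CompactProb) {z : ℂ} (hz : z ≠ 0) :
    stieltjes μ z = μ.stieltjesAtInfty z⁻¹ := by
  rw [stieltjes, stieltjesAtInfty, momentSeries, ← integral_const_mul]
  congr 1 with t
  rw [← mul_inv, mul_sub, mul_one, mul_inv_cancel_left₀ hz]

lemma eventually_stieltjes_eq (μ : CompactProb) :
    ∀ᶠ z in cobounded ℂ, stieltjes μ z = μ.stieltjesAtInfty z⁻¹ := by
  filter_upwards [eventually_ne_cobounded (0 : ℂ)] with z hz using μ.stieltjes_eq hz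

end CompactProb

/-- An analytic function with nonvanishing derivative maps punctured neighbourhoods onto
punctured neighbourhoods. -/
lemma AnalyticAt.map_nhdsNE_eq {f : ℂ → ℂ} {x : ℂ} (hf : AnalyticAt ℂ f x)
    (hf' : deriv f x ≠ 0) : map f (𝓝[≠] x) = 𝓝[≠] (f x) := by
  have hs := hf.hasStrictDerivAt
  refine le_antisymm (hf.map_nhdsNE ?_) ?_
  · intro h
    obtain ⟨c, hc⟩ := eventuallyConst_iff_exists_eventuallyEq.1 h
    exact hf' (by rw [Filter.EventuallyEq.deriv_eq hc]; simp)
  · intro s hs'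
    rw [mem_map, mem_nhdsWithin_iff_eventually] at hs'
    rw [mem_nhdsWithin_iff_eventually, ← hs.map_nhds_eq hf', eventually_map]
    filter_upwards [hs'] with y hy hne
    exact hy fun h ↦ hne (by rw [h]; rfl)

namespace CompactProb

/-- Equality of filters, not just convergence, lets one substitute `w = G_μ(z)` in either direction.
-/
lemma map_stieltjes (μ : CompactProb) : map (stieltjes μ) (cobounded ℂ) = 𝓝[≠] 0 := by
  have h := μ.analyticAt_stieltjesAtInfty.map_nhdsNE_eq
    (by rw [μ.deriv_stieltjesAtInfty_zero]; exact one_ne_zero)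
  rw [stieltjesAtInfty_zero] at h
  rw [Filter.map_congr μ.eventually_stieltjes_eq, ← h, ← inv_cobounded₀, ← Filter.map_inv,
    Filter.map_map]
  rfl

lemma tendsto_stieltjes (μ : CompactProb) :
    Tendsto (stieltjes μ) (cobounded ℂ) (𝓝[≠] 0) := μ.map_stieltjes.le

lemma tendsto_stieltjes_nhds (μ : CompactProb) :
    Tendsto (stieltjes μ) (cobounded ℂ) (𝓝 0) :=
  μ.tendsto_stieltjes.mono_right nhdsWithin_le_nhds

lemma eventually_nhdsNE_iff (μ : CompactProb) {p : ℂ → Prop} :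
    (∀ᶠ w in 𝓝[≠] 0, p w) ↔ ∀ᶠ z in cobounded ℂ, p (stieltjes μ z) := by
  rw [← μ.map_stieltjes, eventually_map]

lemma integrable_of_continuous (μ : CompactProb) {f : ℝ → ℝ} (hf : Continuous f) :
    Integrable f (μ.1 : Measure ℝ) := by
  obtain ⟨M, -, hM⟩ := μ.exists_ae_abs_le
  obtain ⟨C, hC⟩ := (isCompact_Icc (a := -M) (b := M)).exists_bound_of_continuousOn hf.continuousOn
  refine Integrable.of_bound hf.aestronglyMeasurable C ?_
  filter_upwards [hM] with t ht using hC t (abs_le.1 ht)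

/-- A compactly supported probability measure is determined by its moments. -/
lemma ext_of_moments {μ ν : CompactProb}
    (h : ∀ n : ℕ, ∫ t : ℝ, t ^ n ∂(μ.1 : Measure ℝ) = ∫ t : ℝ, t ^ n ∂(ν.1 : Measure ℝ)) :
    μ = ν := by
  apply Subtype.ext
  apply Subtype.ext
  change (μ.1 : Measure ℝ) = (ν.1 : Measure ℝ)
  have hpoly : ∀ p : Polynomial ℝ,
      ∫ t : ℝ, p.eval t ∂(μ.1 : Measure ℝ) = ∫ t : ℝ, p.eval t ∂(ν.1 : Measure ℝ) := by
    intro p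
    simp only [Polynomial.eval_eq_sum_range]
    rw [integral_finsetSum, integral_finsetSum]
    · simp only [integral_const_mul, h]
    all_goals exact fun i _ ↦ integrable_of_continuous _ (by fun_prop)
  obtain ⟨M, hM0, hM⟩ := μ.exists_ae_abs_le
  obtain ⟨N, hN0, hN⟩ := ν.exists_ae_abs_le
  apply ext_of_forall_integral_eq_of_IsFiniteMeasure
  intro f
  have key : ∀ (ρ : CompactProb) (K ε : ℝ) (p : Polynomial ℝ), (∀ᵐ t ∂(ρ.1 : Measure ℝ), |t| ≤ K) →
      (∀ x ∈ Set.Icc (-K) K, |p.eval x - f x| < ε) →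
      |∫ t : ℝ, p.eval t ∂(ρ.1 : Measure ℝ) - ∫ t : ℝ, f t ∂(ρ.1 : Measure ℝ)| ≤ ε := by
    intro ρ K ε p hK hp
    rw [← integral_sub (ρ.integrable_of_continuous (by fun_prop))
      (ρ.integrable_of_continuous f.continuous)]
    have := norm_integral_le_of_norm_le_const (μ := (ρ.1 : Measure ℝ))
      (f := fun t ↦ p.eval t - f t) (C := ε) ?_
    · simpa using this
    · filter_upwards [hK] with t ht using (hp t (abs_le.1 ht)).le
  refine eq_of_forall_dist_le fun ε hε ↦ ?_
  -- Weierstrass approximation on an interval carrying both measures.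
  obtain ⟨p, hp⟩ := exists_polynomial_near_of_continuousOn (-(max M N)) (max M N) f
    f.continuous.continuousOn (ε / 2) (by positivity)
  have h1 := key μ _ _ p (hM.mono fun t ht ↦ ht.trans (le_max_left _ _)) hp
  have h2 := key ν _ _ p (hN.mono fun t ht ↦ ht.trans (le_max_right _ _)) hp
  rw [hpoly p] at h1
  rw [Real.dist_eq]
  rw [abs_le] at h1 h2 ⊢
  constructor <;> linarith

/-- A compactly supported probability measure is determined by its Stieltjes transform near
infinity. -/
lemma ext_of_stieltjes {μ ν : CompactProb}
    (h : ∀ᶠ z in cobounded ℂ, stieltjes μ z = stieltjes ν z) : μ = ν := by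
  have h1 : ∀ᶠ w in 𝓝[≠] (0 : ℂ), μ.momentSeries w = ν.momentSeries w := by
    rw [← inv_cobounded₀, ← Filter.map_inv, eventually_map]
    filter_upwards [h, eventually_ne_cobounded (0 : ℂ)] with z hz hz0
    rw [μ.stieltjes_eq hz0, ν.stieltjes_eq hz0] at hz
    exact mul_left_cancel₀ (inv_ne_zero hz0) hz
  have h2 : μ.momentSeries =ᶠ[𝓝 0] ν.momentSeries :=
    (μ.hasFPowerSeriesAt_momentSeries.analyticAt.frequently_eq_iff_eventually_eq
      ν.hasFPowerSeriesAt_momentSeries.analyticAt).1 h1.frequently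
  have h3 := (μ.hasFPowerSeriesAt_momentSeries.congr h2).eq_formalMultilinearSeries
    ν.hasFPowerSeriesAt_momentSeries
  refine ext_of_moments fun n ↦ ?_
  have h4 := congrArg (fun p ↦ p.coeff n) h3
  simp only [FormalMultilinearSeries.coeff_ofScalars] at h4
  simp only [← Complex.ofReal_pow, integral_complex_ofReal] at h4
  exact_mod_cast h4

/-- A relation between Stieltjes transforms that holds on a real ray holds near infinity. -/
lemma eventually_stieltjes_of_real {μ ν : CompactProb} {φ : ℂ → ℂ} (hφ : AnalyticAt ℂ φ 0)
    (h : ∀ᶠ x : ℝ in atTop, stieltjes μ x = φ (stieltjes ν x)) :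
    ∀ᶠ z in cobounded ℂ, stieltjes μ z = φ (stieltjes ν z) := by
  have hφ' : AnalyticAt ℂ (fun w ↦ φ (ν.stieltjesAtInfty w)) 0 :=
    AnalyticAt.comp (g := φ) (f := ν.stieltjesAtInfty) (by simpa using hφ)
      ν.analyticAt_stieltjesAtInfty
  -- The points `1/x` accumulate at `0`, so the identity theorem applies in the coordinate `w =
  -- 1/z`.
  have hreal : Tendsto (fun x : ℝ ↦ ((x : ℂ))⁻¹) atTop (𝓝[≠] 0) := by
    rw [← inv_cobounded₀, ← Filter.map_inv]
    exact tendsto_map.comp (tendsto_norm_atTop_iff_cobounded.1 (by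
      simpa using tendsto_abs_atTop_atTop))
  have h1 : ∃ᶠ w in 𝓝[≠] (0 : ℂ), μ.stieltjesAtInfty w = φ (ν.stieltjesAtInfty w) := by
    refine hreal.frequently (Eventually.frequently ?_)
    filter_upwards [h, eventually_gt_atTop 0] with x hx hx0
    have : (x : ℂ) ≠ 0 := by exact_mod_cast hx0.ne'
    rwa [μ.stieltjes_eq this, ν.stieltjes_eq this] at hx
  have h2 := (μ.analyticAt_stieltjesAtInfty.frequently_eq_iff_eventually_eq hφ').1 h1
  filter_upwards [tendsto_inv₀_cobounded.eventually h2, eventually_ne_cobounded (0 : ℂ)]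
    with z hz hz0
  rwa [μ.stieltjes_eq hz0, ν.stieltjes_eq hz0]

end CompactProb

/-! ### R-transforms under a change of variables. -/

lemma exists_isRTransform (μ : CompactProb) : ∃ R, IsRTransform μ R := by
  have hg := μ.analyticAt_stieltjesAtInfty
  have hg' : deriv μ.stieltjesAtInfty 0 ≠ 0 := by
    rw [μ.deriv_stieltjesAtInfty_zero]; exact one_ne_zero
  set f := hg.hasStrictDerivAt.localInverse _ _ _ hg' with hf
  have hfa : AnalyticAt ℂ f 0 := by simpa using hg.analyticAt_localInverse hg'
  have hleft : ∀ᶠ w in 𝓝 (0 : ℂ), f (μ.stieltjesAtInfty w) = w :=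
    hg.hasStrictDerivAt.eventually_left_inverse hg'
  have hf0 : f 0 = 0 := by simpa using hleft.self_of_nhds
  have hfd : HasDerivAt f 1 0 := by
    have := (hg.hasStrictDerivAt.to_localInverse hg').hasDerivAt
    simpa [μ.deriv_stieltjesAtInfty_zero] using this
  have hk : AnalyticAt ℂ (dslope f 0) 0 := by
    obtain ⟨p, hp⟩ := hfa
    exact ⟨_, hp.has_fpower_series_dslope_fslope⟩
  have hk0 : dslope f 0 0 = 1 := by rw [dslope_same, hfd.deriv]
  have hkk : AnalyticAt ℂ (dslope (dslope f 0) 0) 0 := by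
    obtain ⟨p, hp⟩ := hk
    exact ⟨_, hp.has_fpower_series_dslope_fslope⟩
  -- With `f(w) = w k(w)` and `k(w) = 1 + w l(w)`, one has `1/f(w) - 1/w = (1 - k) / (w k) = -l/k`,
  -- which is analytic at `0`.
  refine ⟨fun w ↦ -(dslope (dslope f 0) 0 w / dslope f 0 w),
    (hkk.div hk (by rw [hk0]; exact one_ne_zero)).neg, ?_⟩
  filter_upwards [tendsto_inv₀_cobounded.eventually hleft, eventually_ne_cobounded (0 : ℂ),
    μ.tendsto_stieltjes.eventually self_mem_nhdsWithin] with z hz hz0 hG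
  rw [← μ.stieltjes_eq hz0] at hz
  generalize stieltjes μ z = w at hz hG
  have hw : w ≠ 0 := hG
  rw [dslope_of_ne _ hw, slope_def_field, hk0, dslope_of_ne _ hw, slope_def_field, hf0, hz]
  field_simp
  ring

lemma IsRTransform.eventuallyEq {μ : CompactProb} {R R' : ℂ → ℂ} (h : IsRTransform μ R)
    (h' : IsRTransform μ R') : ∀ᶠ w in 𝓝[≠] 0, R w = R' w := by
  rw [μ.eventually_nhdsNE_iff]
  filter_upwards [h.2, h'.2] with z hz hz'
  exact add_right_cancel (hz.trans hz'.symm)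

/-- `R(w) + 1/w` inverts both `G_μ` and `G_ν`; evaluating `G_ν(R(w) + 1/w) = w` at `w = G_μ(z)`
gives `G_ν(z) = G_μ(z)`. -/
lemma IsRTransform.measure_unique {μ ν : CompactProb} {R R' : ℂ → ℂ} (h : IsRTransform μ R)
    (h' : IsRTransform ν R') (hR : ∀ᶠ w in 𝓝[≠] 0, R w = R' w) : μ = ν := by
  have h1 : ∀ᶠ w in 𝓝[≠] 0, stieltjes ν (R w + w⁻¹) = w := by
    have h2 : ∀ᶠ w in 𝓝[≠] 0, stieltjes ν (R' w + w⁻¹) = w := by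
      rw [ν.eventually_nhdsNE_iff]
      filter_upwards [h'.2] with z hz
      rw [hz]
    filter_upwards [h2, hR] with w hw hw'
    rwa [hw']
  rw [μ.eventually_nhdsNE_iff] at h1
  apply CompactProb.ext_of_stieltjes
  filter_upwards [h1, h.2] with z h1 h2
  rw [h2] at h1
  exact h1.symm

/-- If `G_μ(z - s) = φ(G_ν(z))` near infinity then the functional inverses of `G_μ` and `G_ν`
satisfy `K_ν(w) = K_μ(φ(w)) + s` near `0`. -/
lemma IsRTransform.of_subordinate {μ ν : CompactProb} {R R' φ : ℂ → ℂ} {s : ℂ}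
    (hR : IsRTransform μ R) (hR' : IsRTransform ν R')
    (h : ∀ᶠ z in cobounded ℂ, stieltjes μ (z - s) = φ (stieltjes ν z)) :
    ∀ᶠ w in 𝓝[≠] 0, R' w + w⁻¹ = R (φ w) + (φ w)⁻¹ + s := by
  rw [ν.eventually_nhdsNE_iff]
  filter_upwards [h, hR'.2, (tendsto_sub_const_cobounded s).eventually hR.2] with z hz h1 h2
  rw [h1, ← hz, h2, sub_add_cancel]

lemma IsRTransform.isQuantizedRTransform {q : ℝ} {μ ν : CompactProb} {R φ : ℂ → ℂ} {s : ℂ}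
    (hφ : ∀ᶠ w in 𝓝[≠] 0, (φ w)⁻¹ + s = qExp q w / (qExp q w - 1))
    (hR : IsRTransform μ R)
    (h : ∀ᶠ z in cobounded ℂ, stieltjes μ (z - s) = φ (stieltjes ν z)) :
    IsQuantizedRTransform q ν (R ∘ φ) := by
  obtain ⟨R', hR'⟩ := exists_isRTransform ν
  refine ⟨R', hR', ?_⟩
  filter_upwards [hφ, hR.of_subordinate hR' h] with w h1 h2
  rw [← h1, Function.comp_apply, one_div]
  linear_combination -h2

lemma IsQuantizedRTransform.eventuallyEq {q : ℝ} {μ : CompactProb} {S S' : ℂ → ℂ}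
    (h : IsQuantizedRTransform q μ S) (h' : IsQuantizedRTransform q μ S') :
    ∀ᶠ w in 𝓝[≠] 0, S w = S' w := by
  obtain ⟨R, hR, hS⟩ := h
  obtain ⟨R', hR', hS'⟩ := h'
  filter_upwards [hS, hS', hR.eventuallyEq hR'] with w h1 h2 h3
  rw [h1, h2, h3]

lemma IsQuantizedRTransform.measure_unique {q : ℝ} {μ ν : CompactProb} {S S' : ℂ → ℂ}
    (h : IsQuantizedRTransform q μ S) (h' : IsQuantizedRTransform q ν S')
    (hS : ∀ᶠ w in 𝓝[≠] 0, S w = S' w) : μ = ν := by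
  obtain ⟨R, hR, h1⟩ := h
  obtain ⟨R', hR', h2⟩ := h'
  refine hR.measure_unique hR' ?_
  filter_upwards [hS, h1, h2] with w h3 h4 h5
  rw [h3, h5] at h4
  linear_combination -h4

/-- A change of variables `φ` of Stieltjes transforms matching the `q`-deformation turns the free
convolution into the quantized one. -/
lemma IsFreeConvolution.isQuantizedConvolution_iff {q : ℝ} {φ : ℂ → ℂ} {s : ℂ}
    (hφ0 : Tendsto φ (𝓝[≠] 0) (𝓝 0))
    (hφ : ∀ᶠ w in 𝓝[≠] 0, (φ w)⁻¹ + s = qExp q w / (qExp q w - 1))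
    {μ₁ μ₂ μ ν₁ ν₂ ν : CompactProb} (hμ : IsFreeConvolution μ₁ μ₂ μ)
    (h₁ : ∀ᶠ z in cobounded ℂ, stieltjes μ₁ (z - s) = φ (stieltjes ν₁ z))
    (h₂ : ∀ᶠ z in cobounded ℂ, stieltjes μ₂ (z - s) = φ (stieltjes ν₂ z))
    (h : ∀ᶠ z in cobounded ℂ, stieltjes μ (z - s) = φ (stieltjes ν z)) (ρ : CompactProb) :
    IsQuantizedConvolution q ν₁ ν₂ ρ ↔ ρ = ν := by
  obtain ⟨R₁, R₂, R, hR₁, hR₂, hR, hadd⟩ := hμ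
  have q₁ := hR₁.isQuantizedRTransform hφ h₁
  have q₂ := hR₂.isQuantizedRTransform hφ h₂
  have q₀ := hR.isQuantizedRTransform hφ h
  have hadd' := hφ0.eventually hadd
  constructor
  · rintro ⟨S₁, S₂, S, hS₁, hS₂, hS, hsum⟩
    refine hS.measure_unique q₀ ?_
    filter_upwards [hsum, hS₁.eventuallyEq q₁, hS₂.eventuallyEq q₂, hadd'] with w a b c d
    simp only [Function.comp_apply] at *
    rw [a, b, c, d]
  · rintro rfl
    exact ⟨_, _, _, q₁, q₂, q₀, hadd'⟩

/-- A change of variables with nonvanishing derivative determines the target measure. -/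
lemma CompactProb.ext_of_subordinate {μ ν ν' : CompactProb} {φ : ℂ → ℂ} {s : ℂ}
    (hφ : AnalyticAt ℂ φ 0) (hφ' : deriv φ 0 ≠ 0)
    (h : ∀ᶠ z in cobounded ℂ, stieltjes μ (z - s) = φ (stieltjes ν z))
    (h' : ∀ᶠ z in cobounded ℂ, stieltjes μ (z - s) = φ (stieltjes ν' z)) : ν = ν' := by
  have hl := hφ.hasStrictDerivAt.eventually_left_inverse hφ'
  apply CompactProb.ext_of_stieltjes
  filter_upwards [h, h', ν.tendsto_stieltjes_nhds.eventually hl,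
    ν'.tendsto_stieltjes_nhds.eventually hl] with z h1 h2 h3 h4
  rw [← h3, ← h4, ← h1, ← h2]

lemma CompactProb.ext_of_subordinate_left {μ μ' ν : CompactProb} {φ : ℂ → ℂ} {s : ℂ}
    (h : ∀ᶠ z in cobounded ℂ, stieltjes μ (z - s) = φ (stieltjes ν z))
    (h' : ∀ᶠ z in cobounded ℂ, stieltjes μ' (z - s) = φ (stieltjes ν z)) : μ = μ' := by
  apply CompactProb.ext_of_stieltjes
  have ht : Tendsto (fun z : ℂ ↦ z + s) (cobounded ℂ) (cobounded ℂ) := 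
    tendsto_add_const_cobounded s
  filter_upwards [ht.eventually h, ht.eventually h'] with z h1 h2
  rw [add_sub_cancel_right] at h1 h2
  rw [h1, h2]

/-! ### Averaged spectral measures of self-adjoint operators. -/

section SpectralAverage

variable {H : Type*} [NormedAddCommGroup H] [InnerProductSpace ℂ H] [CompleteSpace H]

lemma spectrum_subset_Icc_of_norm_le {T : H →L[ℂ] H} {M : ℝ} (hM : ‖T‖ ≤ M) :
    spectrum ℝ T ⊆ Set.Icc (-M) M := by
  intro x hx
  have h1 : (x : ℂ) ∈ spectrum ℂ T := by
    simpa using (spectrum.algebraMap_mem_iff ℂ).2 hx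
  have := spectrum.norm_le_norm_mul_of_mem h1
  rw [Complex.norm_real, Real.norm_eq_abs] at this
  refine abs_le.1 (this.trans ?_)
  calc ‖T‖ * ‖(1 : H →L[ℂ] H)‖ ≤ ‖T‖ * 1 := by gcongr; exact ContinuousLinearMap.norm_id_le
    _ ≤ M := by simpa using hM

lemma re_inner_cfc_nonneg {T : H →L[ℂ] H} (f : ℝ → ℝ) (hf : ∀ x ∈ spectrum ℝ T, 0 ≤ f x) (v : H) :
    0 ≤ (⟪v, cfc f T v⟫_ℂ).re := by
  have h := cfc_nonneg hf
  rw [ContinuousLinearMap.nonneg_iff_isPositive] at h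
  exact h.re_inner_nonneg_right v

lemma continuous_re_inner_cfc {X : Type*} [TopologicalSpace X] {T : X → H →L[ℂ] H}
    (hT : Continuous T) (hsa : ∀ x, IsSelfAdjoint (T x)) {M : ℝ} (hM : ∀ x, ‖T x‖ ≤ M)
    {f : ℝ → ℝ} (hf : Continuous f) (v : H) :
    Continuous fun x ↦ (⟪v, cfc f (T x) v⟫_ℂ).re := by
  have h : Continuous fun x ↦ cfc f (T x) := by
    rw [← continuousOn_univ] at hT ⊢
    exact hT.cfc' (isCompact_Icc (a := -M) (b := M)) f
      (fun x _ ↦ spectrum_subset_Icc_of_norm_le (hM x)) (fun x _ ↦ hsa x)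
  fun_prop

lemma abs_re_inner_cfc_le {T : H →L[ℂ] H}
    {f : ℝ → ℝ} {C : ℝ} (hC0 : 0 ≤ C) (hC : ∀ x ∈ spectrum ℝ T, ‖f x‖ ≤ C) (v : H) :
    ‖(⟪v, cfc f T v⟫_ℂ).re‖ ≤ C * ‖v‖ ^ 2 := by
  calc ‖(⟪v, cfc f T v⟫_ℂ).re‖ ≤ ‖⟪v, cfc f T v⟫_ℂ‖ := Complex.abs_re_le_norm _
    _ ≤ ‖v‖ * ‖cfc f T v‖ := norm_inner_le_norm _ _
    _ ≤ ‖v‖ * (‖cfc f T‖ * ‖v‖) := by gcongr; exact ContinuousLinearMap.le_opNorm _ _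
    _ ≤ ‖v‖ * (C * ‖v‖) := by gcongr; exact norm_cfc_le hC0 hC
    _ = C * ‖v‖ ^ 2 := by ring

/-- The average of the spectral measures at `v` of a continuous bounded family of self-adjoint
operators. -/
lemma exists_averaged_spectral_measure {X : Type*} [TopologicalSpace X] [MeasurableSpace X]
    [OpensMeasurableSpace X] (κ : Measure X) [IsFiniteMeasure κ] {T : X → H →L[ℂ] H}
    (hT : Continuous T) (hsa : ∀ x, IsSelfAdjoint (T x)) {M : ℝ} (hM0 : 0 ≤ M)
    (hM : ∀ x, ‖T x‖ ≤ M) (v : H) :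
    ∃ ν : Measure ℝ, IsFiniteMeasure ν ∧ ν (Set.Icc (-M) M)ᶜ = 0 ∧
      ∀ f : ℝ → ℝ, ContinuousOn f (Set.Icc (-M) M) →
        ∫ t, f t ∂ν = ∫ x, (⟪v, cfc f (T x) v⟫_ℂ).re ∂κ := by
  have hMM : -M ≤ M := by linarith
  let K := Set.Icc (-M) M
  have hext : ∀ g : C_c(K, ℝ), Continuous (Set.IccExtend hMM g) := fun g ↦
    g.continuous.Icc_extend'
  have hint : ∀ g : C_c(K, ℝ), Integrable
      (fun x ↦ (⟪v, cfc (Set.IccExtend hMM g) (T x) v⟫_ℂ).re) κ := by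
    intro g
    obtain ⟨C, hC⟩ := isCompact_univ.exists_bound_of_continuousOn g.continuous.continuousOn
    refine Integrable.of_bound
      (continuous_re_inner_cfc hT hsa hM (hext g) v).aestronglyMeasurable
      (max C 0 * ‖v‖ ^ 2) (ae_of_all _ fun x ↦ abs_re_inner_cfc_le (le_max_right _ _) ?_ v)
    intro y _
    exact (hC _ (Set.mem_univ _)).trans (le_max_left _ _)
  -- Riesz–Markov is applied on `K = [-M, M]`. All the spectra lie in `K`, so how `g` is extended
  -- outside `K` is immaterial.
  let Λ₀ : C_c(K, ℝ) →ₗ[ℝ] ℝ :=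
    { toFun := fun g ↦ ∫ x, (⟪v, cfc (Set.IccExtend hMM g) (T x) v⟫_ℂ).re ∂κ
      map_add' := fun g g' ↦ by
        rw [← integral_add (hint g) (hint g')]
        congr 1 with x
        have : Set.IccExtend hMM (⇑g + ⇑g') =
          fun y ↦ Set.IccExtend hMM g y + Set.IccExtend hMM g' y := rfl
        rw [CompactlySupportedContinuousMap.coe_add, this,
          cfc_add _ _ _ (hext g).continuousOn (hext g').continuousOn]
        simp
      map_smul' := fun c g ↦ by
        rw [RingHom.id_apply, smul_eq_mul, ← integral_const_mul]
        congr 1 with x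
        have : Set.IccExtend hMM (c • ⇑g) = fun y ↦ c * Set.IccExtend hMM g y := rfl
        rw [CompactlySupportedContinuousMap.coe_smul, this,
          cfc_const_mul _ _ _ (hext g).continuousOn]
        simp [inner_smul_right_eq_smul] }
  let Λ : C_c(K, ℝ) →ₚ[ℝ] ℝ := PositiveLinearMap.mk₀ Λ₀ fun g hg ↦
    integral_nonneg fun x ↦ re_inner_cfc_nonneg _ (fun y _ ↦ hg _) v
  refine ⟨(RealRMK.rieszMeasure Λ).map Subtype.val, inferInstance, ?_, fun f hf ↦ ?_⟩
  · rw [Measure.map_apply measurable_subtype_coe measurableSet_Icc.compl]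
    simp [K]
  · have hfK : Continuous fun y : K ↦ f y := continuousOn_iff_continuous_domRestrict.1 hf
    rw [(MeasurableEmbedding.subtype_coe measurableSet_Icc).integral_map]
    let g : C_c(K, ℝ) := ⟨⟨fun y : K ↦ f y, hfK⟩, HasCompactSupport.of_compactSpace _⟩
    refine (RealRMK.integral_rieszMeasure Λ g).trans ?_
    change ∫ x, (⟪v, cfc (Set.IccExtend hMM g) (T x) v⟫_ℂ).re ∂κ = _
    congr 1 with x
    rw [cfc_congr (g := f)]
    intro y hy
    have hy' := spectrum_subset_Icc_of_norm_le (hM x) hy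
    change Set.IccExtend hMM (fun y : K ↦ f y) y = f y
    rw [Set.IccExtend_of_mem _ _ hy']

lemma cfc_inv_sub_apply {T : H →L[ℂ] H} (hT : IsSelfAdjoint T) {x : ℝ} (hx : ‖T‖ < x) {v w : H}
    (hw : (x : ℂ) • w - T w = v) : cfc (fun t : ℝ ↦ (x - t)⁻¹) T v = w := by
  have hne : ∀ t ∈ spectrum ℝ T, x - t ≠ 0 := fun t ht ↦ by
    have := (spectrum_subset_Icc_of_norm_le le_rfl ht).2
    linarith
  have h1 : cfc (fun t : ℝ ↦ (x - t)⁻¹) T * cfc (fun t : ℝ ↦ x - t) T = 1 := by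
    rw [← cfc_mul (fun t : ℝ ↦ (x - t)⁻¹) (fun t : ℝ ↦ x - t) T
      (ContinuousOn.inv₀ (by fun_prop) hne) (by fun_prop), ← cfc_const_one ℝ T]
    exact cfc_congr fun t ht ↦ inv_mul_cancel₀ (hne t ht)
  have h2 : cfc (fun t : ℝ ↦ x - t) T = algebraMap ℝ _ x - T := by
    rw [cfc_sub (fun _ ↦ x) (fun t ↦ t) T, cfc_const x T, cfc_id' ℝ T]
  rw [h2] at h1
  have h3 := congrArg (fun S : H →L[ℂ] H ↦ S w) h1
  rw [← hw]
  simpa [Algebra.algebraMap_eq_smul_one] using h3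

lemma re_inner_cfc_one {T : H →L[ℂ] H} (hT : IsSelfAdjoint T) (v : H) :
    (⟪v, cfc (fun _ : ℝ ↦ (1 : ℝ)) T v⟫_ℂ).re = ‖v‖ ^ 2 := by
  rw [cfc_const_one ℝ T, one_apply_eq_self, inner_self_eq_norm_sq_to_K]
  norm_cast

end SpectralAverage

/-! ### Rank-one perturbations of the multiplication operator. -/

/-- With `P = ⟨v, ·⟩ v`, `(x - A - c P) w = v - c G v = (1 - c G) v`, so the perturbed resolvent
sends `v` to `w / (1 - c G)`. The bound `x > ‖A‖ + 1` forces `‖w‖ < 1`, hence `|G| < 1` and `1 - c G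
≠ 0`. -/
lemma inner_cfc_inv_sub_rankOne {H : Type*} [NormedAddCommGroup H] [InnerProductSpace ℂ H]
    [CompleteSpace H] {A : H →L[ℂ] H} (hA : IsSelfAdjoint A) {v w : H} (hv : ‖v‖ = 1)
    {x G c : ℝ} (hx : ‖A‖ + 1 < x) (hc : |c| ≤ 1) (hw : (x : ℂ) • w - A w = v)
    (hG : ⟪v, w⟫_ℂ = G) :
    |G| < 1 ∧ (⟪v, cfc (fun t : ℝ ↦ (x - t)⁻¹)
      (A + (c : ℂ) • InnerProductSpace.rankOne ℂ v v) v⟫_ℂ).re = G / (1 - c * G) := by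
  have hx0 : 0 < x := by linarith [norm_nonneg A]
  have hw1 : ‖w‖ < 1 := by
    have h1 : x * ‖w‖ ≤ ‖A‖ * ‖w‖ + 1 := by
      calc x * ‖w‖ = ‖(x : ℂ) • w‖ := by simp [norm_smul, abs_of_pos hx0]
        _ = ‖A w + v‖ := by rw [← hw]; congr 1; abel
        _ ≤ ‖A w‖ + ‖v‖ := norm_add_le _ _
        _ ≤ ‖A‖ * ‖w‖ + 1 := by rw [hv]; gcongr; exact A.le_opNorm w
    by_contra! h
    nlinarith
  have hG1 : |G| < 1 := by
    calc |G| = ‖⟪v, w⟫_ℂ‖ := by rw [hG, Complex.norm_real, Real.norm_eq_abs]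
      _ ≤ ‖v‖ * ‖w‖ := norm_inner_le_norm _ _
      _ < 1 := by rwa [hv, one_mul]
  refine ⟨hG1, ?_⟩
  have hcG : |c * G| < 1 := by
    rw [abs_mul]
    exact lt_of_le_of_lt (mul_le_of_le_one_left (abs_nonneg _) hc) hG1
  have hne : (1 - c * G : ℝ) ≠ 0 := by linarith [(abs_lt.1 hcG).2]
  have hneC : (1 - c * G : ℂ) ≠ 0 := by exact_mod_cast hne
  set P : H →L[ℂ] H := InnerProductSpace.rankOne ℂ v v with hP
  have hsa : IsSelfAdjoint (A + (c : ℂ) • P) := by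
    refine hA.add (IsSelfAdjoint.smul (by simp [IsSelfAdjoint]) ?_)
    exact (InnerProductSpace.isPositive_rankOne_self (𝕜 := ℂ) v).isSelfAdjoint
  have hnorm : ‖A + (c : ℂ) • P‖ < x := by
    calc ‖A + (c : ℂ) • P‖ ≤ ‖A‖ + ‖(c : ℂ) • P‖ := norm_add_le _ _
      _ ≤ ‖A‖ + 1 := by
        rw [norm_smul, hP, InnerProductSpace.norm_rankOne, hv]
        simpa using hc
      _ < x := hx
  rw [cfc_inv_sub_apply hsa hnorm (w := (1 - c * G : ℂ)⁻¹ • w), inner_smul_right, hG]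
  · rw [← Complex.ofReal_re (G / (1 - c * G))]
    congr 1
    push_cast
    ring
  · simp only [add_apply, smul_apply, map_smul, hP, InnerProductSpace.rankOne_apply, hG]
    have h1 : (x : ℂ) • w = v + A w := by rw [← hw]; abel
    rw [smul_comm, h1]
    have h2 : (1 - c * G : ℂ)⁻¹ • (1 - c * G : ℂ) • v = v := by
      rw [smul_smul, inv_mul_cancel₀ hneC, one_smul]
    calc _ = (1 - c * G : ℂ)⁻¹ • (1 - c * G : ℂ) • v := by
          simp only [smul_add, sub_smul, one_smul, smul_sub, smul_smul]
          rw [mul_left_comm]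
          abel
      _ = v := h2

namespace CompactProb

/-- Multiplication by `t` on `L²(μ)`, with its cyclic vector `1`. -/
lemma exists_mulOperator (μ : CompactProb) :
    ∃ (A : Lp ℂ 2 (μ.1 : Measure ℝ) →L[ℂ] Lp ℂ 2 (μ.1 : Measure ℝ))
      (v : Lp ℂ 2 (μ.1 : Measure ℝ)), IsSelfAdjoint A ∧ ‖v‖ = 1 ∧
      ∃ M : ℝ, ∀ x : ℝ, M < x → ∃ w : Lp ℂ 2 (μ.1 : Measure ℝ), (x : ℂ) • w - A w = v ∧
        ⟪v, w⟫_ℂ = ((∫ t, (x - t)⁻¹ ∂(μ.1 : Measure ℝ) : ℝ) : ℂ) := by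
  obtain ⟨M, hM0, hM⟩ := μ.exists_ae_abs_le
  have hid : MemLp (fun t : ℝ ↦ (t : ℂ)) ⊤ (μ.1 : Measure ℝ) := by
    refine memLp_top_of_bound (by fun_prop) M ?_
    filter_upwards [hM] with t ht
    simpa using ht
  set A : Lp ℂ 2 (μ.1 : Measure ℝ) →L[ℂ] Lp ℂ 2 (μ.1 : Measure ℝ) :=
    (ContinuousLinearMap.mul ℂ ℂ).holderL (μ.1 : Measure ℝ) ⊤ 2 2 hid.toLp with hA
  have hAe : ∀ f : Lp ℂ 2 (μ.1 : Measure ℝ), A f =ᵐ[(μ.1 : Measure ℝ)] fun t ↦ (t : ℂ) * f t := by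
    intro f
    have h1 := (ContinuousLinearMap.mul ℂ ℂ).coeFn_holder (r := 2) (hid.toLp) f
    filter_upwards [h1, hid.coeFn_toLp] with t h1 h2
    rw [hA, ContinuousLinearMap.holderL_apply_apply, h1, h2]
    rfl
  have hone : MemLp (fun _ : ℝ ↦ (1 : ℂ)) 2 (μ.1 : Measure ℝ) := memLp_const 1
  refine ⟨A, hone.toLp, ?_, ?_, M, fun x hx ↦ ?_⟩
  · rw [ContinuousLinearMap.isSelfAdjoint_iff_isSymmetric]
    intro f g
    simp only [ContinuousLinearMap.coe_coe, L2.inner_def]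
    apply integral_congr_ae
    filter_upwards [hAe f, hAe g] with t h1 h2
    rw [h1, h2]
    simp
    ring
  · rw [Lp.norm_toLp, eLpNorm_const _ (by simp) (IsProbabilityMeasure.ne_zero _)]
    simp
  · have hw : MemLp (fun t : ℝ ↦ (((x - t)⁻¹ : ℝ) : ℂ)) 2 (μ.1 : Measure ℝ) := by
      refine MemLp.of_bound (by fun_prop) (x - M)⁻¹ ?_
      filter_upwards [hM] with t ht
      have h1 : x - M ≤ x - t := by linarith [(abs_le.1 ht).2]
      rw [Complex.norm_real, Real.norm_of_nonneg (inv_nonneg.2 (by linarith))]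
      exact inv_anti₀ (by linarith) h1
    refine ⟨hw.toLp, ?_, ?_⟩
    · apply Lp.ext
      filter_upwards [Lp.coeFn_sub ((x : ℂ) • hw.toLp) (A hw.toLp),
        Lp.coeFn_smul (x : ℂ) hw.toLp, hAe hw.toLp, hw.coeFn_toLp, hone.coeFn_toLp, hM]
        with t h1 h2 h3 h4 h5 h6
      rw [h1, Pi.sub_apply, h2, Pi.smul_apply, h3, h4, h5, smul_eq_mul, ← sub_mul]
      have : (x - t) ≠ 0 := by linarith [(abs_le.1 h6).2]
      exact_mod_cast mul_inv_cancel₀ this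
    · rw [L2.inner_def, ← integral_complex_ofReal]
      apply integral_congr_ae
      filter_upwards [hw.coeFn_toLp, hone.coeFn_toLp] with t h1 h2
      rw [h1, h2]
      simp

/-- The average of `G_μ / (1 - c G_μ)` over `c ∈ [-1, 1]` is again a Stieltjes transform. -/
lemma exists_average (μ : CompactProb) (κ : Measure ℝ) [IsProbabilityMeasure κ] {c : ℝ → ℝ}
    (hc : Continuous c) (hc1 : ∀ u, |c u| ≤ 1) :
    ∃ ν : CompactProb, ∀ᶠ x : ℝ in atTop, |∫ t, (x - t)⁻¹ ∂(μ.1 : Measure ℝ)| < 1 ∧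
      ∫ t, (x - t)⁻¹ ∂(ν.1 : Measure ℝ) =
        ∫ u, (∫ t, (x - t)⁻¹ ∂(μ.1 : Measure ℝ)) /
          (1 - c u * ∫ t, (x - t)⁻¹ ∂(μ.1 : Measure ℝ)) ∂κ := by
  obtain ⟨A, v, hA, hv, M, hM⟩ := μ.exists_mulOperator
  let T : ℝ → (Lp ℂ 2 (μ.1 : Measure ℝ) →L[ℂ] Lp ℂ 2 (μ.1 : Measure ℝ)) :=
    fun u ↦ A + (c u : ℂ) • InnerProductSpace.rankOne ℂ v v
  have hT : Continuous T := by fun_prop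
  have hsa : ∀ u, IsSelfAdjoint (T u) := fun u ↦ by
    refine hA.add (IsSelfAdjoint.smul (by simp [IsSelfAdjoint]) ?_)
    exact (InnerProductSpace.isPositive_rankOne_self (𝕜 := ℂ) v).isSelfAdjoint
  have hbound : ∀ u, ‖T u‖ ≤ ‖A‖ + 1 := fun u ↦ by
    refine (norm_add_le _ _).trans ?_
    rw [norm_smul, InnerProductSpace.norm_rankOne, hv]
    simpa using hc1 u
  obtain ⟨ν, hfin, hsupp, hν⟩ :=
    exists_averaged_spectral_measure κ hT hsa (by positivity) hbound v
  have hprob : IsProbabilityMeasure ν := by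
    have h1 := hν (fun _ ↦ 1) continuousOn_const
    simp only [re_inner_cfc_one (hsa _), hv, integral_const] at h1
    refine ⟨?_⟩
    have h3 : ν.real Set.univ = 1 := by simpa using h1
    rwa [measureReal_def, ENNReal.toReal_eq_one_iff] at h3
  refine ⟨⟨⟨ν, hprob⟩, ?_⟩, ?_⟩
  · exact isCompact_Icc.of_isClosed_subset Measure.isClosed_support
      (Measure.support_subset_of_isClosed isClosed_Icc (mem_ae_iff.2 hsupp))
  · filter_upwards [eventually_gt_atTop M, eventually_gt_atTop (‖A‖ + 1)] with x hx hxA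
    obtain ⟨w, hw, hG⟩ := hM x hx
    -- The bound on `G_μ(x)` does not involve `c`, so the parameter `0` is an arbitrary choice.
    refine ⟨(inner_cfc_inv_sub_rankOne hA hv hxA (hc1 0) hw hG).1, ?_⟩
    refine (hν (fun t ↦ (x - t)⁻¹) (ContinuousOn.inv₀ (by fun_prop) fun t ht ↦ ?_)).trans ?_
    · have := ht.2
      linarith
    · congr 1 with u
      exact (inner_cfc_inv_sub_rankOne hA hv hxA (hc1 u) hw hG).2

end CompactProb

/-! ### Integral representation of the power function. -/

/-- The power `x ^ q` as a Stieltjes-type integral, relative to its value at `1`. -/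
lemma exists_integral_rpow_representation {q : ℝ} (hq_gt : -1 < q) (hq_lt : q < 1)
    (hq_ne : q ≠ 0) :
    ∃ D : ℝ, 0 < D ∧ ∀ x : ℝ, 0 < x →
      IntegrableOn (fun u ↦ u ^ q * ((u + x)⁻¹ - (u + 1)⁻¹)) (Set.Ioi 0) ∧
      ∫ u in Set.Ioi (0 : ℝ), u ^ q * ((u + x)⁻¹ - (u + 1)⁻¹) = D * ((1 - x ^ q) / q) := by
  rcases lt_or_gt_of_ne hq_ne with hq | hq
  -- For `q < 0` the known formula is used at exponent `q + 1`; dividing its integrand by `x` leaves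
  -- `u^q / (u + x)`.
  · have hp : q + 1 ∈ Set.Ioo (0 : ℝ) 1 := ⟨by linarith, by linarith⟩
    have hI := Real.integral_rpowIntegrand₀₁_one_pos hp
    refine ⟨-q * ∫ t in Set.Ioi 0, Real.rpowIntegrand₀₁ (q + 1) t 1,
      mul_pos (by linarith) hI, fun x hx ↦ ?_⟩
    have heq : Set.EqOn
        (fun u ↦ x⁻¹ * Real.rpowIntegrand₀₁ (q + 1) u x - Real.rpowIntegrand₀₁ (q + 1) u 1)
        (fun u ↦ u ^ q * ((u + x)⁻¹ - (u + 1)⁻¹)) (Set.Ioi 0) := by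
      intro u hu
      have hu' : 0 < u := hu
      simp only [Real.rpowIntegrand₀₁]
      rw [Real.rpow_add_one hu'.ne']
      field_simp
      ring
    have h1 := Real.integrableOn_rpowIntegrand₀₁_Ioi hp hx.le
    have h2 := Real.integrableOn_rpowIntegrand₀₁_Ioi hp zero_le_one
    refine ⟨(integrableOn_congr_fun heq measurableSet_Ioi).1 ((h1.const_mul _).sub h2), ?_⟩
    rw [← setIntegral_congr_fun measurableSet_Ioi heq, integral_sub (h1.const_mul _) h2,
      integral_const_mul, Real.integral_rpowIntegrand₀₁_eq_rpow_mul_const hp hx.le,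
      Real.rpow_add_one hx.ne']
    field_simp
    ring
  · have hp : q ∈ Set.Ioo (0 : ℝ) 1 := ⟨hq, hq_lt⟩
    have hI := Real.integral_rpowIntegrand₀₁_one_pos hp
    refine ⟨q * ∫ t in Set.Ioi 0, Real.rpowIntegrand₀₁ q t 1, mul_pos hq hI, fun x hx ↦ ?_⟩
    have heq : Set.EqOn
        (fun u ↦ Real.rpowIntegrand₀₁ q u 1 - Real.rpowIntegrand₀₁ q u x)
        (fun u ↦ u ^ q * ((u + x)⁻¹ - (u + 1)⁻¹)) (Set.Ioi 0) := by
      intro u hu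
      simp only [Real.rpowIntegrand₀₁]
      ring
    have h1 := Real.integrableOn_rpowIntegrand₀₁_Ioi hp hx.le
    have h2 := Real.integrableOn_rpowIntegrand₀₁_Ioi hp zero_le_one
    refine ⟨(integrableOn_congr_fun heq measurableSet_Ioi).1 (h2.sub h1), ?_⟩
    rw [← setIntegral_congr_fun measurableSet_Ioi heq, integral_sub h2 h1,
      Real.integral_rpowIntegrand₀₁_eq_rpow_mul_const hp hx.le]
    field_simp

/-- Divide by `g` and let `g → 0`: the left side tends to the mass of `κ`, the right side to the
derivative at `0`, which is `1`. The normalizing constant never has to be computed. -/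
lemma isProbabilityMeasure_of_integral_eq {q : ℝ} (hq_ne : q ≠ 0) (κ : Measure ℝ)
    [IsFiniteMeasure κ]
    (h : ∀ g : ℝ, |g| < 1 → ∫ u, g / (1 - (1 + |u|)⁻¹ * g) ∂κ = (1 - (1 - g) ^ q) / q) :
    IsProbabilityMeasure κ := by
  let F : ℝ → ℝ := fun g ↦ ∫ u, (1 - (1 + |u|)⁻¹ * g)⁻¹ ∂κ
  have hF : ContinuousAt F 0 := by
    have hc : ∀ u : ℝ, |(1 + |u|)⁻¹| ≤ 1 := fun u ↦ by
      rw [abs_of_nonneg (by positivity)]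
      exact inv_le_one_of_one_le₀ (by linarith [abs_nonneg u])
    refine continuousAt_of_dominated (bound := fun _ ↦ 2) ?_ ?_ (integrable_const _) ?_
    · exact Eventually.of_forall fun g ↦ Measurable.aestronglyMeasurable (by fun_prop)
    · filter_upwards [Metric.ball_mem_nhds (0 : ℝ) (by norm_num : (0 : ℝ) < 1 / 2)] with g hg
      refine ae_of_all _ fun u ↦ ?_
      have hg' : |g| < 1 / 2 := by simpa using hg
      have h1 : |(1 + |u|)⁻¹ * g| ≤ 1 / 2 := by
        rw [abs_mul]
        exact (mul_le_of_le_one_left (abs_nonneg _) (hc u)).trans hg'.le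
      have h2 : 1 / 2 ≤ 1 - (1 + |u|)⁻¹ * g := by linarith [(abs_le.1 h1).2]
      rw [Real.norm_of_nonneg (inv_nonneg.2 (by linarith))]
      exact (inv_anti₀ (by norm_num) h2).trans (by norm_num)
    · refine ae_of_all _ fun u ↦ ContinuousAt.inv₀ (by fun_prop) (by simp)
  have hlim : Tendsto F (𝓝[≠] 0) (𝓝 1) := by
    have hd : HasDerivAt (fun g : ℝ ↦ (1 - (1 - g) ^ q) / q) 1 0 := by
      have h1 : HasDerivAt (fun g : ℝ ↦ 1 - g) (-1) 0 := by
        simpa using (hasDerivAt_id (0 : ℝ)).const_sub 1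
      have h2 := ((h1.rpow_const (p := q) (Or.inl (by norm_num))).const_sub 1).div_const q
      convert! h2 using 1
      simp [hq_ne]
    refine hd.tendsto_slope.congr' ?_
    have hball := nhdsWithin_le_nhds (s := {(0 : ℝ)}ᶜ) (Metric.ball_mem_nhds (0 : ℝ) one_pos)
    filter_upwards [self_mem_nhdsWithin, hball] with g hg0 hg
    have hg' : |g| < 1 := by simpa using hg
    rw [slope_def_field]
    simp only [sub_zero, Real.one_rpow, sub_self, zero_div]
    rw [← h g hg', div_eq_iff hg0, mul_comm, ← integral_const_mul]
    rfl
  have h1 : F 0 = 1 := tendsto_nhds_unique (hF.tendsto.mono_left nhdsWithin_le_nhds) hlim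
  refine ⟨?_⟩
  have h2 : κ.real Set.univ = 1 := by simpa [F] using h1
  rwa [measureReal_def, ENNReal.toReal_eq_one_iff] at h2

lemma exists_probabilityMeasure_integral_eq {q : ℝ} (hq_gt : -1 < q) (hq_lt : q < 1)
    (hq_ne : q ≠ 0) :
    ∃ κ : Measure ℝ, IsProbabilityMeasure κ ∧ ∀ g : ℝ, |g| < 1 →
      ∫ u, g / (1 - (1 + |u|)⁻¹ * g) ∂κ = (1 - (1 - g) ^ q) / q := by
  obtain ⟨D, hD, h⟩ := exists_integral_rpow_representation hq_gt hq_lt hq_ne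
  -- For `x = 1 - g`, `1/(u + x) - 1/(u + 1) = (u + 1)⁻² g / (1 - g / (1 + u))`, which dictates this
  -- density. Only `u > 0` counts; `|u|` in the statement makes `c(u)` continuous and bounded by `1`
  -- on all of `ℝ`.
  let ρ : ℝ → ℝ := fun u ↦ D⁻¹ * (u ^ q * ((u + 1) ^ 2)⁻¹)
  have hρ : Measurable ρ := by fun_prop
  have hρ0 : ∀ u ∈ Set.Ioi (0 : ℝ), 0 ≤ ρ u := fun u hu ↦ by
    have : 0 < u := hu
    positivity
  have hint : IntegrableOn ρ (Set.Ioi 0) := by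
    -- At `x = 1/2` the known integrand is `u^q / (2 (u + 1/2) (u + 1))`, and twice this dominates
    -- `u^q / (u + 1)²`.
    refine Integrable.mono' ((h (1 / 2) (by norm_num)).1.const_mul (2 * D⁻¹))
      hρ.aestronglyMeasurable ((ae_restrict_iff' measurableSet_Ioi).2 (ae_of_all _ fun u hu ↦ ?_))
    have hu' : 0 < u := hu
    rw [Real.norm_of_nonneg (hρ0 u hu)]
    have h1 : (u + 1 / 2)⁻¹ - (u + 1)⁻¹ = (1 / 2) * ((u + 1 / 2)⁻¹ * (u + 1)⁻¹) := by
      field_simp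
      ring
    have h2 : ((u + 1) ^ 2)⁻¹ ≤ (u + 1 / 2)⁻¹ * (u + 1)⁻¹ := by
      rw [sq, mul_inv]
      gcongr
      norm_num
    rw [h1]
    calc ρ u ≤ D⁻¹ * (u ^ q * ((u + 1 / 2)⁻¹ * (u + 1)⁻¹)) := by
          simp only [ρ]
          gcongr
      _ = _ := by ring
  let κ := (volume.restrict (Set.Ioi (0 : ℝ))).withDensity fun u ↦ ENNReal.ofReal (ρ u)
  have hfin : IsFiniteMeasure κ := isFiniteMeasure_withDensity_ofReal hint.2
  have hκ : ∀ g : ℝ, |g| < 1 →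
      ∫ u, g / (1 - (1 + |u|)⁻¹ * g) ∂κ = (1 - (1 - g) ^ q) / q := by
    intro g hg
    have hg1 : g < 1 := (abs_lt.1 hg).2
    rw [integral_withDensity_eq_integral_toReal_smul (by fun_prop) (by simp)]
    have heq : Set.EqOn
        (fun u ↦ (ENNReal.ofReal (ρ u)).toReal • (g / (1 - (1 + |u|)⁻¹ * g)))
        (fun u ↦ D⁻¹ * (u ^ q * ((u + (1 - g))⁻¹ - (u + 1)⁻¹))) (Set.Ioi 0) := by
      intro u hu
      have hu' : 0 < u := hu
      have h1 : u + (1 - g) ≠ 0 := by linarith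
      have h2 : 1 - (1 + u)⁻¹ * g = (u + (1 - g)) * (u + 1)⁻¹ := by
        field_simp
        ring
      simp only [ENNReal.toReal_ofReal (hρ0 u hu), abs_of_pos hu', smul_eq_mul, ρ, h2]
      field_simp
      ring
    rw [setIntegral_congr_fun measurableSet_Ioi heq, integral_const_mul,
      (h (1 - g) (by linarith)).2, inv_mul_cancel_left₀ hD.ne']
  exact ⟨κ, isProbabilityMeasure_of_integral_eq hq_ne κ hκ, hκ⟩

/-! ### The changes of variables for `𝔓` and `𝔔`, and the main theorem. -/

namespace CompactProb

lemma stieltjes_ofReal (μ : CompactProb) (x : ℝ) :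
    stieltjes μ x = ((∫ t, (x - t)⁻¹ ∂(μ.1 : Measure ℝ) : ℝ) : ℂ) := by
  rw [stieltjes, ← integral_complex_ofReal]
  push_cast
  rfl

lemma exists_shift (μ : CompactProb) :
    ∃ μ' : CompactProb, ∀ z, stieltjes μ' z = stieltjes μ (z - 1) := by
  obtain ⟨M, -, hM⟩ := μ.exists_ae_abs_le
  have hmeas : Measurable fun t : ℝ ↦ t + 1 := by fun_prop
  refine ⟨⟨μ.1.map hmeas.aemeasurable, ?_⟩, fun z ↦ ?_⟩
  · refine (isCompact_Icc (a := -M + 1) (b := M + 1)).of_isClosed_subset Measure.isClosed_support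
      (Measure.support_subset_of_isClosed isClosed_Icc ?_)
    change ∀ᵐ t ∂((μ.1 : Measure ℝ).map fun t ↦ t + 1), t ∈ Set.Icc (-M + 1) (M + 1)
    refine (ae_map_iff (p := fun t ↦ t ∈ Set.Icc (-M + 1) (M + 1)) hmeas.aemeasurable
      measurableSet_Icc).2 ?_
    filter_upwards [hM] with t ht
    constructor <;> linarith [(abs_le.1 ht).1, (abs_le.1 ht).2]
  · change ∫ t : ℝ, (z - (t : ℂ))⁻¹ ∂((μ.1 : Measure ℝ).map fun t ↦ t + 1) = _
    rw [integral_map hmeas.aemeasurable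
      (Measurable.aestronglyMeasurable (by fun_prop)), stieltjes]
    congr 1 with t
    push_cast
    congr 1
    ring

end CompactProb

lemma ofReal_rpow_cpow_one_div {a q : ℝ} (ha : 0 < a) (hq : q ≠ 0) :
    (((a ^ q : ℝ)) : ℂ) ^ (1 / (q : ℂ)) = a := by
  have h : (1 / (q : ℂ)) = ((1 / q : ℝ) : ℂ) := by push_cast; rfl
  rw [h, ← Complex.ofReal_cpow (Real.rpow_nonneg ha.le q), ← Real.rpow_mul ha.le,
    mul_one_div_cancel hq, Real.rpow_one]

/-- The change of variables `w ↦ 1 - (1 - q w)^(1/q)` relating `G_μ` to `G_{𝔓(μ)}`. -/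
noncomputable def pTransform (q : ℝ) (w : ℂ) : ℂ := 1 - (1 - (q : ℂ) * w) ^ (1 / (q : ℂ))

/-- The change of variables `w ↦ (1 - q w)^(-1/q) - 1` relating `G_μ(· - 1)` to `G_{𝔔(μ)}`. -/
noncomputable def qTransform (q : ℝ) (w : ℂ) : ℂ := (1 - (q : ℂ) * w) ^ (-1 / (q : ℂ)) - 1

lemma pRelation_iff {q : ℝ} {μ ν : CompactProb} :
    PRelation q μ ν ↔
      ∀ᶠ z in cobounded ℂ, stieltjes μ (z - 0) = pTransform q (stieltjes ν z) := by
  refine eventually_congr (Eventually.of_forall fun z ↦ ?_)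
  rw [sub_zero, pTransform, sub_eq_iff_eq_add, eq_sub_iff_add_eq, add_comm, eq_comm]

lemma qRelation_iff {q : ℝ} {μ ν : CompactProb} :
    QRelation q μ ν ↔
      ∀ᶠ z in cobounded ℂ, stieltjes μ (z - 1) = qTransform q (stieltjes ν z) := by
  refine eventually_congr (Eventually.of_forall fun z ↦ ?_)
  rw [qTransform, eq_sub_iff_add_eq, add_comm]

lemma analyticAt_one_sub_mul_cpow (q : ℝ) (a : ℂ) :
    AnalyticAt ℂ (fun w : ℂ ↦ (1 - (q : ℂ) * w) ^ a) 0 :=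
  AnalyticAt.cpow (by fun_prop) analyticAt_const (by simp)

lemma hasDerivAt_one_sub_mul_cpow (q : ℝ) (a : ℂ) :
    HasDerivAt (fun w : ℂ ↦ (1 - (q : ℂ) * w) ^ a) (-(a * q)) 0 := by
  have h1 : HasDerivAt (fun w : ℂ ↦ 1 - (q : ℂ) * w) (-q) 0 := by
    simpa using ((hasDerivAt_id (0 : ℂ)).const_mul (q : ℂ)).const_sub 1
  convert! h1.cpow_const (c := a) (by simp) using 1
  simp

lemma analyticAt_pTransform (q : ℝ) : AnalyticAt ℂ (pTransform q) 0 :=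
  analyticAt_const.sub (analyticAt_one_sub_mul_cpow q _)

lemma analyticAt_qTransform (q : ℝ) : AnalyticAt ℂ (qTransform q) 0 :=
  (analyticAt_one_sub_mul_cpow q _).sub analyticAt_const

lemma deriv_pTransform_zero {q : ℝ} (hq : q ≠ 0) : deriv (pTransform q) 0 = 1 := by
  have hq' : (q : ℂ) ≠ 0 := by exact_mod_cast hq
  have h : HasDerivAt (pTransform q) 1 0 := by
    convert! (hasDerivAt_one_sub_mul_cpow q (1 / (q : ℂ))).const_sub 1 using 1
    field_simp
  exact h.deriv

lemma deriv_qTransform_zero {q : ℝ} (hq : q ≠ 0) : deriv (qTransform q) 0 = 1 := by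
  have hq' : (q : ℂ) ≠ 0 := by exact_mod_cast hq
  have h : HasDerivAt (qTransform q) 1 0 := by
    convert! (hasDerivAt_one_sub_mul_cpow q (-1 / (q : ℂ))).sub_const 1 using 1
    field_simp
  exact h.deriv

lemma tendsto_pTransform {q : ℝ} (hq : q ≠ 0) :
    Tendsto (pTransform q) (𝓝[≠] 0) (𝓝[≠] 0) := by
  have h := (analyticAt_pTransform q).map_nhdsNE_eq (by simp [deriv_pTransform_zero hq])
  exact h.le.trans_eq (by simp [pTransform])

lemma tendsto_qTransform {q : ℝ} (hq : q ≠ 0) :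
    Tendsto (qTransform q) (𝓝[≠] 0) (𝓝[≠] 0) := by
  have h := (analyticAt_qTransform q).map_nhdsNE_eq (by simp [deriv_qTransform_zero hq])
  exact h.le.trans_eq (by simp [qTransform])

lemma eventually_inv_pTransform (q : ℝ) :
    ∀ᶠ w in 𝓝[≠] (0 : ℂ), (pTransform q w)⁻¹ + 0 = qExp q w / (qExp q w - 1) := by
  have hc : ContinuousAt (fun w : ℂ ↦ 1 - (q : ℂ) * w) 0 := by fun_prop
  filter_upwards [nhdsWithin_le_nhds (hc.eventually_ne (by simp : 1 - (q : ℂ) * 0 ≠ 0))] with w hw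
  have hy : (1 - (q : ℂ) * w) ^ (1 / (q : ℂ)) ≠ 0 := by simp [Complex.cpow_eq_zero_iff, hw]
  rw [pTransform, qExp, neg_div, Complex.cpow_neg]
  generalize (1 - (q : ℂ) * w) ^ (1 / (q : ℂ)) = y at hy
  rw [← mul_div_mul_left _ _ hy, mul_sub, mul_inv_cancel₀ hy, mul_one, add_zero, one_div]

lemma eventually_inv_qTransform {q : ℝ} (hq : q ≠ 0) :
    ∀ᶠ w in 𝓝[≠] (0 : ℂ), (qTransform q w)⁻¹ + 1 = qExp q w / (qExp q w - 1) := by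
  filter_upwards [(tendsto_qTransform hq).eventually self_mem_nhdsWithin] with w hw
  have hw' : qExp q w - 1 ≠ 0 := hw
  change (qExp q w - 1)⁻¹ + 1 = _
  field_simp
  ring

lemma abs_inv_one_add_abs_le (u : ℝ) : |(1 + |u|)⁻¹| ≤ 1 := by
  rw [abs_of_nonneg (by positivity)]
  exact inv_le_one_of_one_le₀ (by linarith [abs_nonneg u])

lemma continuous_inv_one_add_abs : Continuous fun u : ℝ ↦ (1 + |u|)⁻¹ :=
  Continuous.inv₀ (by fun_prop) fun u ↦ by positivity

lemma exists_pRelation {q : ℝ} (hq_gt : -1 < q) (hq_lt : q < 1) (hq_ne : q ≠ 0)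
    (μ : CompactProb) : ∃ ν : CompactProb, PRelation q μ ν := by
  obtain ⟨κ, hκ, h⟩ := exists_probabilityMeasure_integral_eq hq_gt hq_lt hq_ne
  obtain ⟨ν, hν⟩ := μ.exists_average κ continuous_inv_one_add_abs abs_inv_one_add_abs_le
  refine ⟨ν, pRelation_iff.2 ?_⟩
  simp only [sub_zero]
  refine CompactProb.eventually_stieltjes_of_real (analyticAt_pTransform q) ?_
  filter_upwards [hν] with x hx
  rw [μ.stieltjes_ofReal, ν.stieltjes_ofReal, hx.2, h _ hx.1, pTransform]
  generalize ∫ t, (x - t)⁻¹ ∂(μ.1 : Measure ℝ) = g at hx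
  have h1 : (1 - (q : ℂ) * (((1 - (1 - g) ^ q) / q : ℝ) : ℂ)) = (((1 - g) ^ q : ℝ) : ℂ) := by
    rw [← Complex.ofReal_mul, mul_div_cancel₀ _ hq_ne]
    push_cast
    ring
  rw [h1, ofReal_rpow_cpow_one_div (by linarith [(abs_lt.1 hx.1).2]) hq_ne]
  push_cast
  ring

lemma exists_qRelation {q : ℝ} (hq_gt : -1 < q) (hq_lt : q < 1) (hq_ne : q ≠ 0)
    (μ : CompactProb) : ∃ ν : CompactProb, QRelation q μ ν := by
  -- Inverting the relation gives `G_λ = (1 - (1 + g)^(-q)) / q`, the representation for `-q`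
  -- evaluated at `-g`; the sign of `g` moves into the coefficient `c`.
  obtain ⟨κ, hκ, h⟩ := exists_probabilityMeasure_integral_eq (q := -q) (by linarith) (by linarith)
    (neg_ne_zero.2 hq_ne)
  obtain ⟨μ', hμ'⟩ := μ.exists_shift
  obtain ⟨ν, hν⟩ := μ'.exists_average κ (c := fun u ↦ -(1 + |u|)⁻¹) continuous_inv_one_add_abs.neg
    fun u ↦ by rw [abs_neg]; exact abs_inv_one_add_abs_le u
  refine ⟨ν, qRelation_iff.2 ?_⟩
  simp only [← hμ']
  refine CompactProb.eventually_stieltjes_of_real (analyticAt_qTransform q) ?_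
  filter_upwards [hν] with x hx
  rw [μ'.stieltjes_ofReal, ν.stieltjes_ofReal, hx.2, qTransform]
  generalize ∫ t, (x - t)⁻¹ ∂(μ'.1 : Measure ℝ) = g at hx
  have h0 : ∫ u, g / (1 - -(1 + |u|)⁻¹ * g) ∂κ = (1 - (1 + g) ^ (-q)) / q := by
    have h1 := h (-g) (by rw [abs_neg]; exact hx.1)
    rw [sub_neg_eq_add, div_neg] at h1
    rw [← neg_inj, ← h1, ← integral_neg]
    congr 1 with u
    ring
  have h1 : (1 - (q : ℂ) * (((1 - (1 + g) ^ (-q)) / q : ℝ) : ℂ)) =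
      (((1 + g) ^ (-q) : ℝ) : ℂ) := by
    rw [← Complex.ofReal_mul, mul_div_cancel₀ _ hq_ne]
    push_cast
    ring
  have h2 : (-1 / (q : ℂ)) = 1 / ((-q : ℝ) : ℂ) := by
    push_cast
    rw [neg_div, div_neg]
  rw [h0, h1, h2, ofReal_rpow_cpow_one_div (by linarith [(abs_lt.1 hx.1).1]) (neg_ne_zero.2 hq_ne)]
  push_cast
  ring

/-- By the first two clauses there is exactly one choice of `P` and `Q`. Each equivalence with `ρ =
P ν` or `ρ = Q ν` encodes existence, uniqueness and the value of the quantized convolution at once.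
-/
theorem mainTheorem7 (q : ℝ) (hq_gt : -1 < q) (hq_lt : q < 1) (hq_ne : q ≠ 0) :
    (∀ μ : CompactProb, ∃! ν : CompactProb, PRelation q μ ν) ∧
    (∀ μ : CompactProb, ∃! lam : CompactProb, QRelation q μ lam) ∧
    ∀ P Q : CompactProb → CompactProb,
      (∀ μ, PRelation q μ (P μ)) → (∀ μ, QRelation q μ (Q μ)) →
      Function.Injective P ∧ Function.Injective Q ∧
      ∀ ν₁ ν₂ ν : CompactProb, IsFreeConvolution ν₁ ν₂ ν →
        (∀ ρ : CompactProb, IsQuantizedConvolution q (P ν₁) (P ν₂) ρ ↔ ρ = P ν) ∧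
        (∀ ρ : CompactProb, IsQuantizedConvolution q (Q ν₁) (Q ν₂) ρ ↔ ρ = Q ν) := by
  refine ⟨fun μ ↦ ?_, fun μ ↦ ?_, fun P Q hP hQ ↦ ?_⟩
  · refine existsUnique_of_exists_of_unique (exists_pRelation hq_gt hq_lt hq_ne μ) fun ν ν' h h' ↦ ?_
    exact CompactProb.ext_of_subordinate (analyticAt_pTransform q)
      (by simp [deriv_pTransform_zero hq_ne]) (pRelation_iff.1 h) (pRelation_iff.1 h')
  · refine existsUnique_of_exists_of_unique (exists_qRelation hq_gt hq_lt hq_ne μ) fun ν ν' h h' ↦ ?_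
    exact CompactProb.ext_of_subordinate (analyticAt_qTransform q)
      (by simp [deriv_qTransform_zero hq_ne]) (qRelation_iff.1 h) (qRelation_iff.1 h')
  · simp only [pRelation_iff] at hP
    simp only [qRelation_iff] at hQ
    refine ⟨fun μ μ' h ↦ ?_, fun μ μ' h ↦ ?_, fun ν₁ ν₂ ν hν ↦ ⟨fun ρ ↦ ?_, fun ρ ↦ ?_⟩⟩
    · exact CompactProb.ext_of_subordinate_left (hP μ) (h ▸ hP μ')
    · exact CompactProb.ext_of_subordinate_left (hQ μ) (h ▸ hQ μ')
    · exact hν.isQuantizedConvolution_iff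
        ((tendsto_pTransform hq_ne).mono_right nhdsWithin_le_nhds)
        (eventually_inv_pTransform q) (hP ν₁) (hP ν₂) (hP ν) ρ
    · exact hν.isQuantizedConvolution_iff
        ((tendsto_qTransform hq_ne).mono_right nhdsWithin_le_nhds)
        (eventually_inv_qTransform hq_ne) (hQ ν₁) (hQ ν₂) (hQ ν) ρ
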